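/- Let $\rho_0,\rho_1$ be density operators on a $D$-dimensional Hilbert space $\mathcal H$, let $0\le t\le 1$, and give $\rho_0,\rho_1$ the prior probabilities $1-t$ and $t$. For a measurement (POVM) $\{E_b\}$ with finitely many outcomes let $p_k(b)=\mathrm{tr}(\rho_kE_b)$, $p=(1-t)p_0+tp_1$ and $$J=H(p)-(1-t)H(p_0)-tH(p_1),\qquad H(q)=-\sum_b q(b)\ln q(b)\quad(0\ln 0=0),$$ and let the accessible information $I(\rho_0|\rho_1)$ be the supremum of $J$ over all such measurements (on the space on which the two states live). A purification of $\rho_k$ is a vector $\psi_k\in\mathcal H\otimes\mathbb C^d$ ($d$ finite) with $\mathrm{tr}_{\mathbb C^d}|\psi_k\rangle\langle\psi_k|=\rho_k$; the two members of a pair of purifications live in the same space. Let $F(\rho_0,\rho_1)=\mathrm{tr}\sqrt{\rho_1^{1/2}\rho_0\rho_1^{1/2}}$. For $0\le q\le 1$ put $n=\sqrt{1-4t(1-t)q}$ and $$\begin{aligned}B(t,q)=\frac1{2n}\Big\{&(1-t)\Big[(n+1-2tq)\ln\tfrac{1+n}{2(1-t)}+(n-1+2tq)\ln\tfrac{1-n}{2(1-t)}\Big]\\&+t\Big[(n+1-2(1-t)q)\ln\tfrac{1+n}{2t}+(n-1+2(1-t)q)\ln\tfrac{1-n}{2t}\Big]\Big\},\end{aligned}$$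 where a logarithmic term with coefficient $0$ counts as $0$, as does $B$ itself in the only case with $n=0$, namely $t=\frac12$, $q=1$. Then the supremum defining $I(\rho_0|\rho_1)$ is finite, and: 1. For every pair of purifications $\psi_0,\psi_1$ of $\rho_0,\rho_1$, $$I(\rho_0|\rho_1)\le I(|\psi_0\rangle\langle\psi_0|\,\big|\,|\psi_1\rangle\langle\psi_1|)=B\big(t,|\langle\psi_0|\psi_1\rangle|^2\big),$$ where the accessible information of the pure states is attained by some measurement. 2. Every pair of purifications satisfies $|\langle\psi_0|\psi_1\rangle|^2\le F(\rho_0,\rho_1)^2$, with equality for some pair, which can be chosen with $d=D$; and $q\mapsto B(t,q)$ is nonincreasing on $[0,1]$. 3. Consequently, with $P(t)=B\big(t,F(\rho_0,\rho_1)^2\big)$, $$I(\rho_0|\rho_1)\le P(t),$$ and $P(t)$ is the least value of $I(|\psi_0\rangle\langle\psi_0|\,\big|\,|\psi_1\rangle\langle\psi_1|)$ over all pairs of purifications of $\rho_0,\rho_1$; that is, it is the best upper bound of this kind. -/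

import Mathlib

open scoped MatrixOrder ComplexOrder

noncomputable section

/-- Density operators on a finite-dimensional Hilbert space with orthonormal basis
indexed by `ι`. -/
structure IsDensityOperator {ι : Type*} [Fintype ι] (ρ : Matrix ι ι ℂ) : Prop where
  posSemidef : ρ.PosSemidef
  trace_eq_one : ρ.trace = 1

/-- A measurement (POVM) with finitely many outcomes `b : Fin m`. -/
structure IsMeasurement {ι : Type*} [DecidableEq ι] {m : ℕ}
    (E : Fin m → Matrix ι ι ℂ) : Prop where
  posSemidef : ∀ b, (E b).PosSemidef
  sum_eq_one : ∑ b, E b = 1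

/-- The probability `tr (ρ E_b)` of the outcome `b` in the state `ρ`. -/
def outcomeProb {ι : Type*} [Fintype ι] {m : ℕ} (ρ : Matrix ι ι ℂ)
    (E : Fin m → Matrix ι ι ℂ) (b : Fin m) : ℝ :=
  (ρ * E b).trace.re

/-- Shannon information in nats, with the convention `0 ln 0 = 0`. -/
def shannonInfo {m : ℕ} (q : Fin m → ℝ) : ℝ :=
  -∑ b, q b * Real.log (q b)

/-- The average state `(1 - t) ρ₀ + t ρ₁`. -/
def averageState {ι : Type*} (t : ℝ) (ρ₀ ρ₁ : Matrix ι ι ℂ) : Matrix ι ι ℂ :=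
  ((1 - t : ℝ) : ℂ) • ρ₀ + (t : ℂ) • ρ₁

/-- Mutual information `J = H(p) - (1-t) H(p₀) - t H(p₁)` of the binary channel with signal
states `ρ₀`, `ρ₁` and prior probabilities `1 - t`, `t`, with respect to a measurement. -/
def mutualInfo {ι : Type*} [Fintype ι] {m : ℕ} (t : ℝ) (ρ₀ ρ₁ : Matrix ι ι ℂ)
    (E : Fin m → Matrix ι ι ℂ) : ℝ :=
  shannonInfo (outcomeProb (averageState t ρ₀ ρ₁) E)
    - (1 - t) * shannonInfo (outcomeProb ρ₀ E) - t * shannonInfo (outcomeProb ρ₁ E)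

/-- All values that the mutual information takes as the measurement varies. -/
def mutualInfoValues {ι : Type*} [Fintype ι] [DecidableEq ι] (t : ℝ)
    (ρ₀ ρ₁ : Matrix ι ι ℂ) : Set ℝ :=
  {x | ∃ (m : ℕ) (E : Fin m → Matrix ι ι ℂ), IsMeasurement E ∧ x = mutualInfo t ρ₀ ρ₁ E}

/-- Accessible information: the mutual information optimized over all measurements. -/
def accessibleInfo {ι : Type*} [Fintype ι] [DecidableEq ι] (t : ℝ)
    (ρ₀ ρ₁ : Matrix ι ι ℂ) : ℝ :=
  sSup (mutualInfoValues t ρ₀ ρ₁)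

/-- The operator `|ψ⟩⟨ψ|`. -/
def ketBra {ι : Type*} (ψ : EuclideanSpace ℂ ι) : Matrix ι ι ℂ :=
  fun i j => ψ i * star (ψ j)

/-- Partial trace over the second factor. -/
def partialTrace {ι κ : Type*} [Fintype κ] (M : Matrix (ι × κ) (ι × κ) ℂ) : Matrix ι ι ℂ :=
  fun i j => ∑ b, M (i, b) (j, b)

/-- `ψ`, a vector of the composite space, is a purification of `ρ`. It is a unit vector as
soon as `ρ` has trace one. -/
def IsPurification {ι κ : Type*} [Fintype κ] (ψ : EuclideanSpace ℂ (ι × κ))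
    (ρ : Matrix ι ι ℂ) : Prop :=
  partialTrace (ketBra ψ) = ρ

/-- The quantum fidelity `tr √(ρ₁^{1/2} ρ₀ ρ₁^{1/2})`. -/
def fidelity {ι : Type*} [Fintype ι] [DecidableEq ι] (ρ₀ ρ₁ : Matrix ι ι ℂ) : ℝ :=
  (CFC.sqrt (CFC.sqrt ρ₁ * ρ₀ * CFC.sqrt ρ₁)).trace.re

/-- The norm `n = √(1 - 4t(1-t)q)`. -/
def helstromNorm (t q : ℝ) : ℝ := Real.sqrt (1 - 4 * t * (1 - t) * q)

/-- The closed form, with `n = helstromNorm t q`, for two pure states of squared overlap `q`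
and priors `1 - t`, `t`. For `0 ≤ t ≤ 1`, `0 ≤ q ≤ 1`: a logarithm of `0` or of a quotient
by `0` occurs only with coefficient `0`; the norm `n` vanishes only when `t = 1/2` and `q = 1`,
and then the expression is `0`, which is its limit value. -/
def pureStateInfo (t q : ℝ) : ℝ :=
  let n := helstromNorm t q
  1 / (2 * n) *
    ((1 - t) * ((n + 1 - 2 * t * q) * Real.log ((1 + n) / (2 * (1 - t)))
        + (n - 1 + 2 * t * q) * Real.log ((1 - n) / (2 * (1 - t))))
      + t * ((n + 1 - 2 * (1 - t) * q) * Real.log ((1 + n) / (2 * t))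
        + (n - 1 + 2 * (1 - t) * q) * Real.log ((1 - n) / (2 * t))))

/-- The bound `P(t)`: the closed form at `q = F(ρ₀, ρ₁)²`. -/
def purificationBound {ι : Type*} [Fintype ι] [DecidableEq ι] (t : ℝ)
    (ρ₀ ρ₁ : Matrix ι ι ℂ) : ℝ :=
  pureStateInfo t (fidelity ρ₀ ρ₁ ^ 2)

/-- The values of the accessible information over all pairs of purifications of `ρ₀`, `ρ₁`,
with auxiliary systems of any finite dimension `k`. -/
def purificationInfoValues {ι : Type*} [Fintype ι] [DecidableEq ι] (t : ℝ)
    (ρ₀ ρ₁ : Matrix ι ι ℂ) : Set ℝ :=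
  {x | ∃ (k : ℕ) (ψ₀ ψ₁ : EuclideanSpace ℂ (ι × Fin k)),
    IsPurification ψ₀ ρ₀ ∧ IsPurification ψ₁ ρ₁ ∧
      x = accessibleInfo t (ketBra ψ₀) (ketBra ψ₁)}

end

/-! Read the mutual information from the side of the signal: `J` is the entropy `h(t)` of the prior
minus the mean entropy of the posterior (`mutualInfo_eq`). Written as a function of the concurrence
`s = 2√(r(1-r))`, the entropy `h(r)` is convex and increasing in `s`. The mean concurrence of the
posteriors is `2√(t(1-t))` times the Bhattacharyya coefficient of the outcome distributions, so
Jensen bounds the mean entropy from below (`concurrenceEntropy_le_sum`). For pure states that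
coefficient is at least the overlap, whatever the measurement, and the resulting bound on `J` is the
closed form (`pureStateInfo_eq`). The projective measurement onto an eigenvector of `(1-t)|ψ₀⟩⟨ψ₀| -
t|ψ₁⟩⟨ψ₁|` leaves posteriors `(1±n)/2` of equal entropy, so the bound is attained.

For mixed states, `E ↦ E ⊗ 1` turns a measurement of `ρ₀`, `ρ₁` into one of any purifications with
the same statistics, whence the upper bound. The closed form decreases in the overlap, and by
Uhlmann's theorem the largest overlap is the fidelity; this gives the optimal bound. -/

/-! ### Binary entropy as a convex increasing function of the concurrence -/

/-- The entropy of a binary distribution `(p, 1 - p)` as a function of its concurrence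
`s = 2 √(p (1 - p))`. -/
noncomputable def concurrenceEntropy (s : ℝ) : ℝ :=
  Real.binEntropy ((1 + Real.sqrt (1 - s ^ 2)) / 2)

theorem convexOn_sinh_Ici : ConvexOn ℝ (Set.Ici 0) Real.sinh := by
  refine MonotoneOn.convexOn_of_deriv (convex_Ici 0) Real.continuous_sinh.continuousOn
    Real.differentiable_sinh.differentiableOn ?_
  rw [Real.deriv_sinh, interior_Ici]
  intro x hx y hy hxy
  rw [Real.cosh_le_cosh, abs_of_pos hx, abs_of_pos hy]
  exact hxy

/-- Slopes of chords from the origin of the convex function `sinh` increase. -/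
theorem div_sinh_le_div_sinh {x y : ℝ} (hx : 0 < x) (hxy : x ≤ y) :
    y / Real.sinh y ≤ x / Real.sinh x := by
  have hy : 0 < y := hx.trans_le hxy
  have h := convexOn_sinh_Ici.2 (Set.self_mem_Ici (a := 0)) (Set.mem_Ici.2 hy.le)
    (sub_nonneg.2 ((div_le_one hy).2 hxy)) (div_pos hx hy).le (sub_add_cancel 1 (x / y))
  simp only [smul_eq_mul, mul_zero, zero_add, Real.sinh_zero] at h
  rw [div_mul_cancel₀ _ hy.ne', div_mul_eq_mul_div, le_div_iff₀ hy] at h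
  rw [div_le_div_iff₀ (Real.sinh_pos_iff.2 hy) (Real.sinh_pos_iff.2 hx)]
  linarith

/-- With `u = √(1 - s²)`, the chain rule gives `(s/u) artanh u`, and `sinh (artanh u) = u/s`. The
form `x / sinh x` makes the monotonicity of the derivative visible: `x = artanh u` decreases in `s`,
and `x / sinh x` decreases in `x`. -/
theorem hasDerivAt_concurrenceEntropy {s : ℝ} (hs₀ : 0 < s) (hs₁ : s < 1) :
    HasDerivAt concurrenceEntropy
      (Real.artanh (Real.sqrt (1 - s ^ 2)) / Real.sinh (Real.artanh (Real.sqrt (1 - s ^ 2)))) s := by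
  have h1 : 0 < 1 - s ^ 2 := by nlinarith
  have hu0 := Real.sqrt_pos.2 h1
  have hsq := Real.sq_sqrt h1.le
  have hu1 : Real.sqrt (1 - s ^ 2) < 1 := by
    rw [Real.sqrt_lt' one_pos]; nlinarith
  have hd : HasDerivAt (fun s : ℝ => (1 + Real.sqrt (1 - s ^ 2)) / 2)
      (-(2 * s) / (2 * Real.sqrt (1 - s ^ 2)) / 2) s := by
    have h2 : HasDerivAt (fun s : ℝ => 1 - s ^ 2) (-(2 * s)) s := by
      simpa using (hasDerivAt_pow 2 s).const_sub 1
    exact ((h2.sqrt h1.ne').const_add 1).div_const 2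
  have hb := Real.hasDerivAt_binEntropy (p := (1 + Real.sqrt (1 - s ^ 2)) / 2)
    (by positivity) (by linarith)
  refine (hb.comp s hd).congr_deriv ?_
  rw [Real.sinh_artanh ⟨by linarith, hu1⟩, Real.artanh_eq_half_log ⟨by linarith, hu1.le⟩, hsq,
    sub_sub_cancel, Real.sqrt_sq hs₀.le]
  set u := Real.sqrt (1 - s ^ 2)
  rw [show 1 - (1 + u) / 2 = (1 - u) / 2 by ring, Real.log_div (by linarith) (by linarith),
    Real.log_div (by linarith) two_ne_zero, Real.log_div (by linarith) (by linarith)]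
  field_simp
  ring

theorem convexOn_concurrenceEntropy : ConvexOn ℝ (Set.Icc 0 1) concurrenceEntropy := by
  refine MonotoneOn.convexOn_of_deriv (convex_Icc 0 1) ?_ ?_ ?_
  · unfold concurrenceEntropy
    fun_prop
  · rw [interior_Icc]
    exact fun s hs =>
      (hasDerivAt_concurrenceEntropy hs.1 hs.2).differentiableAt.differentiableWithinAt
  · rw [interior_Icc]
    intro s hs r hr hsr
    rw [(hasDerivAt_concurrenceEntropy hs.1 hs.2).deriv,
      (hasDerivAt_concurrenceEntropy hr.1 hr.2).deriv]
    have key : ∀ x ∈ Set.Ioo (0 : ℝ) 1, Real.sqrt (1 - x ^ 2) ∈ Set.Ioo (0 : ℝ) 1 := by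
      intro x hx
      refine ⟨Real.sqrt_pos.2 (by nlinarith [hx.1, hx.2]), ?_⟩
      rw [Real.sqrt_lt' one_pos]
      nlinarith [hx.1]
    refine div_sinh_le_div_sinh (Real.artanh_pos (key r hr)) ?_
    refine Real.artanh_le_artanh (by linarith [(key r hr).1]) (key s hs).2 ?_
    refine Real.sqrt_le_sqrt ?_
    nlinarith [hs.1]

theorem monotoneOn_concurrenceEntropy : MonotoneOn concurrenceEntropy (Set.Ici 0) := by
  intro s hs r hr hsr
  have h2 : Real.sqrt (1 - r ^ 2) ≤ Real.sqrt (1 - s ^ 2) := by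
    refine Real.sqrt_le_sqrt ?_
    nlinarith [Set.mem_Ici.1 hs]
  have h3 : Real.sqrt (1 - s ^ 2) ≤ 1 := by
    exact Real.sqrt_le_one.2 (by nlinarith [sq_nonneg s])
  have h4 := Real.sqrt_nonneg (1 - r ^ 2)
  refine Real.binEntropy_strictAntiOn.antitoneOn ?_ ?_ (by linarith)
  · constructor <;> linarith
  · constructor <;> linarith

/-- Here `√(1 - s²) = |1 - 2r|`, and the symmetry of `h` under `r ↦ 1 - r` absorbs the sign. -/
theorem binEntropy_eq_concurrenceEntropy {r : ℝ} (hr₀ : 0 ≤ r) (hr₁ : r ≤ 1) :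
    Real.binEntropy r = concurrenceEntropy (2 * Real.sqrt (r * (1 - r))) := by
  have h : 1 - (2 * Real.sqrt (r * (1 - r))) ^ 2 = (1 - 2 * r) ^ 2 := by
    rw [mul_pow, Real.sq_sqrt (mul_nonneg hr₀ (by linarith))]
    ring
  rw [concurrenceEntropy, h, Real.sqrt_sq_eq_abs]
  rcases abs_cases (1 - 2 * r) with ⟨h1, _⟩ | ⟨h1, _⟩ <;> rw [h1]
  · rw [← Real.binEntropy_one_sub]
    congr 1
    ring
  · congr 1
    ring

/-! ### The closed form as a difference of entropies -/

theorem helstromNorm_mem_Icc {t q : ℝ} (ht₀ : 0 ≤ t) (ht₁ : t ≤ 1) (hq₀ : 0 ≤ q) :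
    helstromNorm t q ∈ Set.Icc 0 1 := by
  have h : 0 ≤ t * (1 - t) * q := mul_nonneg (mul_nonneg ht₀ (by linarith)) hq₀
  refine ⟨Real.sqrt_nonneg _, ?_⟩
  exact Real.sqrt_le_one.2 (by linarith)

theorem four_mul_mul_one_sub_mul_le_one {t q : ℝ} (ht₀ : 0 ≤ t) (ht₁ : t ≤ 1)
    (hq₁ : q ≤ 1) : 4 * t * (1 - t) * q ≤ 1 := by
  have h : 0 ≤ t * (1 - t) := mul_nonneg ht₀ (by linarith)
  nlinarith [sq_nonneg (1 - 2 * t)]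

theorem helstromNorm_sq {t q : ℝ} (ht₀ : 0 ≤ t) (ht₁ : t ≤ 1) (hq₁ : q ≤ 1) :
    helstromNorm t q ^ 2 = 1 - 4 * t * (1 - t) * q :=
  Real.sq_sqrt (sub_nonneg.2 (four_mul_mul_one_sub_mul_le_one ht₀ ht₁ hq₁))

theorem concurrenceEntropy_eq_helstromNorm {t q : ℝ} (ht₀ : 0 ≤ t) (ht₁ : t ≤ 1) (hq₀ : 0 ≤ q) :
    concurrenceEntropy (2 * Real.sqrt (t * (1 - t) * q))
      = Real.binEntropy ((1 + helstromNorm t q) / 2) := by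
  have h : 0 ≤ t * (1 - t) * q := mul_nonneg (mul_nonneg ht₀ (by linarith)) hq₀
  rw [concurrenceEntropy, helstromNorm, mul_pow, Real.sq_sqrt h]
  ring_nf

theorem pureStateInfo_eq {t q : ℝ} (ht₀ : 0 ≤ t) (ht₁ : t ≤ 1) (hq₀ : 0 ≤ q) (hq₁ : q ≤ 1) :
    pureStateInfo t q
      = Real.binEntropy t - concurrenceEntropy (2 * Real.sqrt (t * (1 - t) * q)) := by
  rw [concurrenceEntropy_eq_helstromNorm ht₀ ht₁ hq₀]
  obtain ⟨hn₀, hn₁⟩ := helstromNorm_mem_Icc (q := q) ht₀ ht₁ hq₀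
  have hn := helstromNorm_sq ht₀ ht₁ hq₁
  unfold pureStateInfo
  set n := helstromNorm t q
  rw [Real.binEntropy_eq_negMulLog_add_negMulLog_one_sub,
    Real.binEntropy_eq_negMulLog_add_negMulLog_one_sub]
  simp only [Real.negMulLog]
  rw [show 1 - (1 + n) / 2 = (1 - n) / 2 by ring]
  rcases ht₀.eq_or_lt with rfl | ht₀'
  · have : n = 1 := by nlinarith
    simp [this]
  rcases ht₁.eq_or_lt with rfl | ht₁'
  · have : n = 1 := by nlinarith
    simp [this]
  have ht2 : 0 < 1 - t := by linarith
  -- `n = 0` forces `t = 1/2`; the prefactor `1/(2n)` is then `0` by convention, and the two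
  -- entropies on the right cancel.
  rcases hn₀.eq_or_lt with hn0 | hn0
  · have h1 : t * (1 - t) = 1 / 4 := by nlinarith [sq_nonneg (1 - 2 * t), mul_pos ht₀' ht2]
    have h2 : t = 1 / 2 := by nlinarith [sq_nonneg (1 - 2 * t)]
    rw [← hn0, h2]
    norm_num
  rcases hn₁.eq_or_lt with hn1 | hn1
  · have h1 : t * (1 - t) * q = 0 := by rw [hn1] at hn; linarith
    have h2 : q = 0 := by
      rcases mul_eq_zero.1 h1 with h | h
      · exact absurd h (mul_pos ht₀' ht2).ne'
      · exact h
    rw [hn1, h2]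
    have hlog : ∀ x : ℝ, Real.log ((1 + 1) / (2 * x)) = -Real.log x := fun x => by
      rw [one_add_one_eq_two, div_mul_cancel_left₀ two_ne_zero, Real.log_inv]
    rw [hlog, hlog]
    norm_num
    ring
  rw [Real.log_div (by linarith) (by positivity), Real.log_div (by linarith) (by positivity),
    Real.log_div (by linarith) (by positivity), Real.log_div (by linarith) (by positivity),
    Real.log_mul (by norm_num) ht2.ne', Real.log_mul (by norm_num) ht₀'.ne',
    Real.log_div (by linarith) (by norm_num), Real.log_div (by linarith) (by norm_num)]
  -- All logarithms are now split; eliminating `q` in favour of `n` leaves a rational identity.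
  have hq' : q = (1 - n ^ 2) / (4 * t * (1 - t)) := by
    rw [hn]
    field_simp
    ring
  rw [hq']
  field_simp
  ring

theorem antitoneOn_pureStateInfo {t : ℝ} (ht₀ : 0 ≤ t) (ht₁ : t ≤ 1) :
    AntitoneOn (fun q => pureStateInfo t q) (Set.Icc 0 1) := by
  intro q hq r hr hqr
  simp only
  rw [pureStateInfo_eq ht₀ ht₁ hq.1 hq.2, pureStateInfo_eq ht₀ ht₁ hr.1 hr.2]
  refine sub_le_sub_left (monotoneOn_concurrenceEntropy ?_ ?_ ?_) _
  · exact mul_nonneg two_pos.le (Real.sqrt_nonneg _)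
  · exact mul_nonneg two_pos.le (Real.sqrt_nonneg _)
  · have : 0 ≤ t * (1 - t) := mul_nonneg ht₀ (by linarith)
    gcongr

/-! ### Mutual information through the posterior distributions -/

/-- Bayes' rule for one outcome. The remainder is linear in `a` and `b`, so summing over outcomes
turns it into the entropy of the prior. -/
theorem mutualInfo_term_eq {t a b : ℝ} (ht₀ : 0 ≤ t) (ht₁ : t ≤ 1) (ha : 0 ≤ a) (hb : 0 ≤ b) :
    -(((1 - t) * a + t * b) * Real.log ((1 - t) * a + t * b))
        + (1 - t) * (a * Real.log a) + t * (b * Real.log b)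
      = -(((1 - t) * a + t * b) * Real.binEntropy (t * b / ((1 - t) * a + t * b)))
        - (1 - t) * Real.log (1 - t) * a - t * Real.log t * b := by
  have hta : 0 ≤ (1 - t) * a := mul_nonneg (by linarith) ha
  have htb : 0 ≤ t * b := mul_nonneg ht₀ hb
  have hlog : ∀ s x p : ℝ, 0 < p → s * x * Real.log (s * x / p)
      = s * (x * Real.log x) + s * Real.log s * x - s * x * Real.log p := by
    intro s x p hp
    rcases eq_or_ne s 0 with rfl | hs
    · simp
    rcases eq_or_ne x 0 with rfl | hx
    · simp
    rw [Real.log_div (mul_ne_zero hs hx) hp.ne', Real.log_mul hs hx]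
    ring
  rcases (add_nonneg hta htb).eq_or_lt with hp | hp
  · have h1 : (1 - t) * a = 0 := by linarith
    have h2 : t * b = 0 := by linarith
    rw [← hp]
    linear_combination (Real.log a + Real.log (1 - t)) * h1 + (Real.log b + Real.log t) * h2
  · have h1 := hlog (1 - t) a _ hp
    have h2 := hlog t b _ hp
    set p := (1 - t) * a + t * b with hpdef
    have h3 : 1 - t * b / p = (1 - t) * a / p := by
      rw [eq_div_iff hp.ne', sub_mul, div_mul_cancel₀ _ hp.ne']
      linarith
    rw [Real.binEntropy_eq_negMulLog_add_negMulLog_one_sub, h3, Real.negMulLog, Real.negMulLog]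
    have h4 : p * (-(t * b / p) * Real.log (t * b / p) +
        -((1 - t) * a / p) * Real.log ((1 - t) * a / p))
        = -(t * b * Real.log (t * b / p)) - (1 - t) * a * Real.log ((1 - t) * a / p) := by
      field_simp
      ring
    rw [h4, h1, h2, hpdef]
    ring

theorem outcomeProb_averageState {ι : Type*} [Fintype ι] {m : ℕ} (t : ℝ) (ρ₀ ρ₁ : Matrix ι ι ℂ)
    (E : Fin m → Matrix ι ι ℂ) (b : Fin m) :
    outcomeProb (averageState t ρ₀ ρ₁) E b
      = (1 - t) * outcomeProb ρ₀ E b + t * outcomeProb ρ₁ E b := by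
  simp only [outcomeProb, averageState, add_mul, Matrix.smul_mul, Matrix.trace_add,
    Matrix.trace_smul, smul_eq_mul, Complex.add_re, Complex.re_ofReal_mul]

theorem mutualInfo_eq {ι : Type*} [Fintype ι] {m : ℕ} {t : ℝ} (ht₀ : 0 ≤ t) (ht₁ : t ≤ 1)
    {ρ₀ ρ₁ : Matrix ι ι ℂ} {E : Fin m → Matrix ι ι ℂ}
    (h₀ : ∀ b, 0 ≤ outcomeProb ρ₀ E b) (h₁ : ∀ b, 0 ≤ outcomeProb ρ₁ E b)
    (hs₀ : ∑ b, outcomeProb ρ₀ E b = 1) (hs₁ : ∑ b, outcomeProb ρ₁ E b = 1) :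
    mutualInfo t ρ₀ ρ₁ E = Real.binEntropy t
      - ∑ b, ((1 - t) * outcomeProb ρ₀ E b + t * outcomeProb ρ₁ E b)
        * Real.binEntropy (t * outcomeProb ρ₁ E b
          / ((1 - t) * outcomeProb ρ₀ E b + t * outcomeProb ρ₁ E b)) := by
  have h := Finset.sum_congr (rfl : (Finset.univ : Finset (Fin m)) = Finset.univ)
    fun b _ => mutualInfo_term_eq ht₀ ht₁ (h₀ b) (h₁ b)
  simp only [Finset.sum_add_distrib, Finset.sum_sub_distrib, Finset.sum_neg_distrib,
    ← Finset.mul_sum, hs₀, hs₁] at h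
  simp only [mutualInfo, shannonInfo, outcomeProb_averageState]
  rw [Real.binEntropy_eq_negMulLog_add_negMulLog_one_sub, Real.negMulLog, Real.negMulLog]
  linear_combination h

/-- The conditional entropy of a binary signal given the outcome is bounded below in terms of the
Bhattacharyya coefficient of the two conditional distributions. -/
theorem concurrenceEntropy_le_sum {β : Type*} [Fintype β] {t : ℝ} (ht₀ : 0 ≤ t) (ht₁ : t ≤ 1)
    {p₀ p₁ : β → ℝ} (h₀ : ∀ b, 0 ≤ p₀ b) (h₁ : ∀ b, 0 ≤ p₁ b)
    (hs₀ : ∑ b, p₀ b = 1) (hs₁ : ∑ b, p₁ b = 1) :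
    concurrenceEntropy (2 * Real.sqrt (t * (1 - t)) * ∑ b, Real.sqrt (p₀ b * p₁ b))
      ≤ ∑ b, ((1 - t) * p₀ b + t * p₁ b)
        * Real.binEntropy (t * p₁ b / ((1 - t) * p₀ b + t * p₁ b)) := by
  have hta : ∀ b, 0 ≤ (1 - t) * p₀ b := fun b => mul_nonneg (by linarith) (h₀ b)
  have htb : ∀ b, 0 ≤ t * p₁ b := fun b => mul_nonneg ht₀ (h₁ b)
  have hp : ∀ b, 0 ≤ (1 - t) * p₀ b + t * p₁ b := fun b => add_nonneg (hta b) (htb b)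
  have hr₀ : ∀ b, 0 ≤ t * p₁ b / ((1 - t) * p₀ b + t * p₁ b) := fun b =>
    div_nonneg (htb b) (hp b)
  have hr₁ : ∀ b, t * p₁ b / ((1 - t) * p₀ b + t * p₁ b) ≤ 1 := fun b =>
    div_le_one_of_le₀ (by linarith [hta b]) (hp b)
  -- Jensen, with the outcome probabilities as weights and the concurrences of the posteriors as
  -- points.
  have hj := convexOn_concurrenceEntropy.map_sum_le (t := Finset.univ)
    (w := fun b => (1 - t) * p₀ b + t * p₁ b)
    (p := fun b => 2 * Real.sqrt (t * p₁ b / ((1 - t) * p₀ b + t * p₁ b)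
      * (1 - t * p₁ b / ((1 - t) * p₀ b + t * p₁ b)))) (fun b _ => hp b)
    (by rw [Finset.sum_add_distrib, ← Finset.mul_sum, ← Finset.mul_sum, hs₀, hs₁]; ring)
    (fun b _ => ⟨by positivity, by
      have : Real.sqrt (t * p₁ b / ((1 - t) * p₀ b + t * p₁ b)
        * (1 - t * p₁ b / ((1 - t) * p₀ b + t * p₁ b))) ≤ 1 / 2 := by
        rw [Real.sqrt_le_left (by norm_num)]
        nlinarith [sq_nonneg (1 / 2 - t * p₁ b / ((1 - t) * p₀ b + t * p₁ b))]
      linarith⟩)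
  simp only [smul_eq_mul] at hj
  -- Moving the weight under the root cancels the normalization of the posterior. An outcome of
  -- weight zero has posterior `0/0 = 0`.
  have hl : 2 * Real.sqrt (t * (1 - t)) * ∑ b, Real.sqrt (p₀ b * p₁ b)
      = ∑ b, ((1 - t) * p₀ b + t * p₁ b) * (2 * Real.sqrt (t * p₁ b /
        ((1 - t) * p₀ b + t * p₁ b) * (1 - t * p₁ b / ((1 - t) * p₀ b + t * p₁ b)))) := by
    rw [Finset.mul_sum]
    refine Finset.sum_congr rfl fun b _ => ?_
    rw [mul_assoc, ← Real.sqrt_mul (mul_nonneg ht₀ (by linarith)), mul_left_comm _ (2 : ℝ)]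
    congr 1
    nth_rw 1 [← Real.sqrt_sq (hp b)]
    rw [← Real.sqrt_mul (sq_nonneg _)]
    congr 1
    rcases (hp b).eq_or_lt with h | h
    · have h2 : t * p₁ b = 0 := by linarith [hta b, htb b]
      rw [← h]
      linear_combination (1 - t) * p₀ b * h2
    · field_simp
      ring
  rw [hl]
  refine hj.trans_eq (Finset.sum_congr rfl fun b _ => ?_)
  rw [binEntropy_eq_concurrenceEntropy (hr₀ b) (hr₁ b)]

/-! ### Upper bound for two pure states -/

section PureStates

variable {ι : Type*} [Fintype ι]

theorem trace_ketBra_mul (ψ : EuclideanSpace ℂ ι) (M : Matrix ι ι ℂ) :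
    (ketBra ψ * M).trace = inner ℂ ψ (WithLp.toLp 2 (M.mulVec ψ)) := by
  simp only [Matrix.trace, Matrix.diag, Matrix.mul_apply, ketBra, PiLp.inner_apply,
    Matrix.mulVec, dotProduct, RCLike.inner_apply, Finset.sum_mul]
  rw [Finset.sum_comm]
  refine Finset.sum_congr rfl fun i _ => Finset.sum_congr rfl fun j _ => ?_
  simp only [starRingEnd_apply]
  ring

theorem inner_mulVec_conjTranspose_mul_self {κ : Type*} [Fintype κ] (B : Matrix κ ι ℂ)
    (x y : EuclideanSpace ℂ ι) :
    inner ℂ x (WithLp.toLp 2 ((B.conjTranspose * B).mulVec y))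
      = inner ℂ (WithLp.toLp 2 (B.mulVec x) : EuclideanSpace ℂ κ) (WithLp.toLp 2 (B.mulVec y)) := by
  rw [EuclideanSpace.inner_eq_star_dotProduct, EuclideanSpace.inner_eq_star_dotProduct]
  simp only [← Matrix.mulVec_mulVec, Matrix.star_mulVec]
  rw [dotProduct_comm, Matrix.dotProduct_mulVec, dotProduct_comm]

theorem norm_inner_sq_mem_Icc {ψ₀ ψ₁ : EuclideanSpace ℂ ι} (h₀ : ‖ψ₀‖ = 1) (h₁ : ‖ψ₁‖ = 1) :
    ‖inner ℂ ψ₀ ψ₁‖ ^ 2 ∈ Set.Icc (0 : ℝ) 1 := by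
  have h := norm_inner_le_norm (𝕜 := ℂ) ψ₀ ψ₁
  rw [h₀, h₁, one_mul] at h
  exact ⟨by positivity, pow_le_one₀ (norm_nonneg _) h⟩

variable [DecidableEq ι]

/-- Factoring `E b = B* B` makes probabilities squared norms and matrix elements inner products,
ready for Cauchy–Schwarz. -/
theorem exists_outcomeProb_ketBra_eq {m : ℕ} {E : Fin m → Matrix ι ι ℂ} (hE : IsMeasurement E)
    (b : Fin m) : ∃ B : Matrix ι ι ℂ, (∀ ψ : EuclideanSpace ℂ ι, outcomeProb (ketBra ψ) E b
        = ‖(WithLp.toLp 2 (B.mulVec ψ) : EuclideanSpace ℂ ι)‖ ^ 2) ∧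
      ∀ ψ φ : EuclideanSpace ℂ ι, inner ℂ ψ (WithLp.toLp 2 ((E b).mulVec φ))
        = inner ℂ (WithLp.toLp 2 (B.mulVec ψ) : EuclideanSpace ℂ ι)
          (WithLp.toLp 2 (B.mulVec φ)) := by
  obtain ⟨B, hB⟩ := CStarAlgebra.nonneg_iff_eq_star_mul_self.1 (hE.posSemidef b).nonneg
  rw [Matrix.star_eq_conjTranspose] at hB
  refine ⟨B, fun ψ => ?_, fun ψ φ => ?_⟩
  · rw [outcomeProb, trace_ketBra_mul, hB, inner_mulVec_conjTranspose_mul_self,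
      inner_self_eq_norm_sq_to_K]
    norm_cast
  · rw [hB, inner_mulVec_conjTranspose_mul_self]

theorem outcomeProb_ketBra_nonneg {m : ℕ} {E : Fin m → Matrix ι ι ℂ} (hE : IsMeasurement E)
    (ψ : EuclideanSpace ℂ ι) (b : Fin m) : 0 ≤ outcomeProb (ketBra ψ) E b := by
  obtain ⟨B, hB, -⟩ := exists_outcomeProb_ketBra_eq hE b
  rw [hB]
  positivity

theorem sum_outcomeProb {m : ℕ} {E : Fin m → Matrix ι ι ℂ} (hE : IsMeasurement E)
    (ρ : Matrix ι ι ℂ) : ∑ b, outcomeProb ρ E b = ρ.trace.re := by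
  simp only [outcomeProb]
  rw [← Complex.re_sum, ← Matrix.trace_sum, ← Finset.mul_sum, hE.sum_eq_one, mul_one]

theorem trace_ketBra (ψ : EuclideanSpace ℂ ι) : (ketBra ψ).trace = (‖ψ‖ : ℂ) ^ 2 := by
  have h := trace_ketBra_mul ψ (1 : Matrix ι ι ℂ)
  rw [mul_one, Matrix.one_mulVec] at h
  rw [h]
  exact inner_self_eq_norm_sq_to_K ψ

theorem sum_outcomeProb_ketBra {m : ℕ} {E : Fin m → Matrix ι ι ℂ} (hE : IsMeasurement E)
    {ψ : EuclideanSpace ℂ ι} (hψ : ‖ψ‖ = 1) : ∑ b, outcomeProb (ketBra ψ) E b = 1 := by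
  rw [sum_outcomeProb hE, trace_ketBra, hψ]
  simp

/-- The overlap of two pure states is at most the Bhattacharyya coefficient of the outcome
distributions of any measurement. -/
theorem norm_inner_le_sum_sqrt_outcomeProb {m : ℕ} {E : Fin m → Matrix ι ι ℂ}
    (hE : IsMeasurement E) (ψ₀ ψ₁ : EuclideanSpace ℂ ι) :
    ‖inner ℂ ψ₀ ψ₁‖
      ≤ ∑ b, Real.sqrt (outcomeProb (ketBra ψ₀) E b * outcomeProb (ketBra ψ₁) E b) := by
  -- Insert `∑ E_b = 1` and apply Cauchy–Schwarz to each outcome.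
  have h : inner ℂ ψ₀ ψ₁ = ∑ b, inner ℂ ψ₀ (WithLp.toLp 2 ((E b).mulVec ψ₁)) := by
    rw [← inner_sum, ← WithLp.toLp_sum, ← Matrix.sum_mulVec, hE.sum_eq_one, Matrix.one_mulVec]
  rw [h]
  refine (norm_sum_le _ _).trans (Finset.sum_le_sum fun b _ => ?_)
  obtain ⟨B, hB, hB'⟩ := exists_outcomeProb_ketBra_eq hE b
  rw [hB, hB, hB', ← mul_pow, Real.sqrt_sq (by positivity)]
  exact norm_inner_le_norm _ _

theorem mutualInfo_ketBra_le {t : ℝ} (ht₀ : 0 ≤ t) (ht₁ : t ≤ 1)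
    {ψ₀ ψ₁ : EuclideanSpace ℂ ι} (h₀ : ‖ψ₀‖ = 1) (h₁ : ‖ψ₁‖ = 1)
    {m : ℕ} {E : Fin m → Matrix ι ι ℂ} (hE : IsMeasurement E) :
    mutualInfo t (ketBra ψ₀) (ketBra ψ₁) E ≤ pureStateInfo t (‖inner ℂ ψ₀ ψ₁‖ ^ 2) := by
  have hq := norm_inner_sq_mem_Icc h₀ h₁
  have hp₀ := outcomeProb_ketBra_nonneg hE ψ₀
  have hp₁ := outcomeProb_ketBra_nonneg hE ψ₁
  have hs₀ := sum_outcomeProb_ketBra hE h₀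
  have hs₁ := sum_outcomeProb_ketBra hE h₁
  rw [mutualInfo_eq ht₀ ht₁ hp₀ hp₁ hs₀ hs₁, pureStateInfo_eq ht₀ ht₁ hq.1 hq.2]
  refine sub_le_sub_left (le_trans ?_ (concurrenceEntropy_le_sum ht₀ ht₁ hp₀ hp₁ hs₀ hs₁)) _
  have ht : 0 ≤ t * (1 - t) := mul_nonneg ht₀ (by linarith)
  rw [Real.sqrt_mul ht, Real.sqrt_sq (norm_nonneg _), ← mul_assoc]
  refine monotoneOn_concurrenceEntropy (Set.mem_Ici.2 (by positivity))
    (Set.mem_Ici.2 (mul_nonneg (by positivity) (Finset.sum_nonneg fun _ _ => Real.sqrt_nonneg _)))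
    ?_
  gcongr
  exact norm_inner_le_sum_sqrt_outcomeProb hE ψ₀ ψ₁

end PureStates

/-! ### Attainment by a two-outcome projective measurement -/

theorem ketBra_eq_vecMulVec {ι : Type*} (e : EuclideanSpace ℂ ι) :
    ketBra e = Matrix.vecMulVec e.ofLp (star e.ofLp) := rfl

theorem ketBra_smul {ι : Type*} {ω : ℂ} (hω : ‖ω‖ = 1) (ψ : EuclideanSpace ℂ ι) :
    ketBra (ω • ψ) = ketBra ψ := by
  ext i j
  have h : ω * star ω = 1 := by
    rw [Complex.star_def, Complex.mul_conj, Complex.normSq_eq_norm_sq, hω]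
    norm_num
  simp only [ketBra, PiLp.smul_apply, smul_eq_mul, star_mul]
  linear_combination ψ i * star (ψ j) * h

theorem isMeasurement_one {ι : Type*} [DecidableEq ι] :
    IsMeasurement (fun _ : Fin 1 => (1 : Matrix ι ι ℂ)) :=
  ⟨fun _ => Matrix.PosSemidef.one, by simp⟩

section Attainment

variable {ι : Type*} [Fintype ι]

theorem ketBra_mulVec (e ψ : EuclideanSpace ℂ ι) :
    WithLp.toLp 2 ((ketBra e).mulVec ψ) = (inner ℂ e ψ : ℂ) • e := by
  ext i
  rw [ketBra_eq_vecMulVec, Matrix.vecMulVec_mulVec, EuclideanSpace.inner_eq_star_dotProduct,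
    dotProduct_comm]
  simp [mul_comm]

theorem re_trace_ketBra_mul_ketBra (ψ e : EuclideanSpace ℂ ι) :
    (ketBra ψ * ketBra e).trace.re = ‖inner ℂ e ψ‖ ^ 2 := by
  rw [trace_ketBra_mul, ketBra_mulVec, inner_smul_right, ← inner_conj_symm ψ e, RCLike.mul_conj]
  norm_cast

theorem norm_eq_one_of_inner_self_eq_one {v : EuclideanSpace ℂ ι} (h : inner ℂ v v = (1 : ℂ)) :
    ‖v‖ = 1 := by
  have h' : ‖v‖ ^ 2 = 1 := by
    rw [← inner_self_eq_norm_sq (𝕜 := ℂ), h, RCLike.one_re]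
  exact (pow_eq_one_iff_of_nonneg (norm_nonneg _) two_ne_zero).1 h'

/-- Solve the Gram system for `e` in the span of `ψ₀`, `ψ₁`; its determinant is `1 - c²`, and `hab`
says that the solution has norm one. -/
theorem exists_unit_vector_inner_eq {ψ₀ ψ₁ : EuclideanSpace ℂ ι} (h₀ : ‖ψ₀‖ = 1) (h₁ : ‖ψ₁‖ = 1)
    {c a b : ℝ} (hc : inner ℂ ψ₀ ψ₁ = (c : ℂ)) (hc₁ : c ^ 2 < 1)
    (hab : a ^ 2 + b ^ 2 - 2 * a * b * c = 1 - c ^ 2) :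
    ∃ e : EuclideanSpace ℂ ι, ‖e‖ = 1 ∧ inner ℂ e ψ₀ = (a : ℂ) ∧ inner ℂ e ψ₁ = (b : ℂ) := by
  have hc' : inner ℂ ψ₁ ψ₀ = (c : ℂ) := by rw [← inner_conj_symm, hc, Complex.conj_ofReal]
  have h00 : inner ℂ ψ₀ ψ₀ = (1 : ℂ) := by rw [inner_self_eq_norm_sq_to_K, h₀]; norm_num
  have h11 : inner ℂ ψ₁ ψ₁ = (1 : ℂ) := by rw [inner_self_eq_norm_sq_to_K, h₁]; norm_num
  have hd : 1 - c ^ 2 ≠ 0 := by linarith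
  set x : ℝ := (a - c * b) / (1 - c ^ 2) with hx
  set y : ℝ := (b - c * a) / (1 - c ^ 2) with hy
  have hxa : x + y * c = a := by rw [hx, hy]; field_simp; ring
  have hyb : x * c + y = b := by rw [hx, hy]; field_simp; ring
  have hxy : x * a + y * b = 1 := by
    rw [hx, hy]; field_simp; linarith
  have he₀ : inner ℂ ((x : ℂ) • ψ₀ + (y : ℂ) • ψ₁) ψ₀ = (a : ℂ) := by
    rw [inner_add_left, inner_smul_left, inner_smul_left, h00, hc', ← hxa]
    simp
  have he₁ : inner ℂ ((x : ℂ) • ψ₀ + (y : ℂ) • ψ₁) ψ₁ = (b : ℂ) := by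
    rw [inner_add_left, inner_smul_left, inner_smul_left, h11, hc, ← hyb]
    simp
  refine ⟨(x : ℂ) • ψ₀ + (y : ℂ) • ψ₁, ?_, he₀, he₁⟩
  have hn : inner ℂ ((x : ℂ) • ψ₀ + (y : ℂ) • ψ₁) ((x : ℂ) • ψ₀ + (y : ℂ) • ψ₁) = (1 : ℂ) := by
    rw [inner_add_right, inner_smul_right, inner_smul_right, he₀, he₁]
    exact_mod_cast hxy
  exact norm_eq_one_of_inner_self_eq_one hn

variable [DecidableEq ι]

theorem isMeasurement_ketBra {e : EuclideanSpace ℂ ι} (he : ‖e‖ = 1) :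
    IsMeasurement ![ketBra e, 1 - ketBra e] := by
  have hpos : (ketBra e).PosSemidef := by
    rw [ketBra_eq_vecMulVec]
    exact Matrix.posSemidef_vecMulVec_self_star _
  have hself : star e.ofLp ⬝ᵥ e.ofLp = 1 := by
    rw [dotProduct_comm, ← EuclideanSpace.inner_eq_star_dotProduct, inner_self_eq_norm_sq_to_K, he]
    norm_num
  have hidem : ketBra e * ketBra e = ketBra e := by
    rw [ketBra_eq_vecMulVec, Matrix.vecMulVec_mul_vecMulVec, hself, one_smul]
  refine ⟨fun b => ?_, by simp⟩
  fin_cases b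
  · exact hpos
  · have h : 1 - ketBra e = (1 - ketBra e).conjTranspose * (1 - ketBra e) := by
      rw [Matrix.conjTranspose_sub, Matrix.conjTranspose_one, hpos.isHermitian.eq]
      simp [sub_mul, mul_sub, hidem]
    show (1 - ketBra e).PosSemidef
    rw [h]
    exact Matrix.posSemidef_conjTranspose_mul_self _

theorem mutualInfo_self_one {t : ℝ} (ρ : Matrix ι ι ℂ) :
    mutualInfo t ρ ρ (fun _ : Fin 1 => 1) = 0 := by
  have h : averageState t ρ ρ = ρ := by
    rw [averageState, ← add_smul, ← Complex.ofReal_add, sub_add_cancel, Complex.ofReal_one,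
      one_smul]
  rw [mutualInfo, h]
  ring

/-- The vector `e` is the eigenvector of `(1-t)|ψ₀⟩⟨ψ₀| - t|ψ₁⟩⟨ψ₁|` for the eigenvalue `(1 - 2t +
n)/2`; `a` and `b` below are its inner products with the two states. -/
theorem exists_mutualInfo_ketBra_eq_of_inner_eq {t : ℝ} (ht₀ : 0 ≤ t) (ht₁ : t ≤ 1)
    {ψ₀ ψ₁ : EuclideanSpace ℂ ι} (h₀ : ‖ψ₀‖ = 1) (h₁ : ‖ψ₁‖ = 1) {c : ℝ} (hc₀ : 0 ≤ c)
    (hc₁ : c < 1) (hc : inner ℂ ψ₀ ψ₁ = (c : ℂ)) :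
    ∃ E : Fin 2 → Matrix ι ι ℂ, IsMeasurement E ∧
      mutualInfo t (ketBra ψ₀) (ketBra ψ₁) E = pureStateInfo t (c ^ 2) := by
  have hq₁ : c ^ 2 < 1 := by nlinarith
  have hq₀ : 0 ≤ c ^ 2 := sq_nonneg c
  have hn2 := helstromNorm_sq ht₀ ht₁ hq₁.le
  obtain ⟨hn₀, hn₁⟩ := helstromNorm_mem_Icc (q := c ^ 2) ht₀ ht₁ hq₀
  rw [pureStateInfo_eq ht₀ ht₁ hq₀ hq₁.le, concurrenceEntropy_eq_helstromNorm ht₀ ht₁ hq₀]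
  set n := helstromNorm t (c ^ 2)
  set q := c ^ 2
  have ht : 0 ≤ t * (1 - t) := mul_nonneg ht₀ (by linarith)
  have hn : 0 < n := by
    refine hn₀.lt_of_ne fun h => ?_
    rw [← h] at hn2
    nlinarith [sq_nonneg (1 - 2 * t)]
  have hA : 0 ≤ (n + 1 - 2 * t * q) / (2 * n) := by
    refine div_nonneg ?_ (by positivity)
    have h : (2 * t * q - 1) ^ 2 ≤ n ^ 2 := by
      have := mul_nonneg (mul_nonneg ht₀ hq₀) (mul_nonneg ht₀ (sub_nonneg.2 hq₁.le))
      nlinarith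
    linarith [(abs_le_of_sq_le_sq' h hn.le).2]
  have hB : 0 ≤ (n - 1 + 2 * (1 - t) * q) / (2 * n) := by
    refine div_nonneg ?_ (by positivity)
    have h : (1 - 2 * (1 - t) * q) ^ 2 ≤ n ^ 2 := by
      have := mul_nonneg (mul_nonneg (sq_nonneg (1 - t)) hq₀) (sub_nonneg.2 hq₁.le)
      nlinarith
    linarith [(abs_le_of_sq_le_sq' h hn.le).2]
  have hC : 0 ≤ (n + 1 - 2 * t) / n := by
    refine div_nonneg ?_ hn.le
    have h : (2 * t - 1) ^ 2 ≤ n ^ 2 := by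
      have := mul_nonneg ht (sub_nonneg.2 hq₁.le)
      nlinarith
    linarith [(abs_le_of_sq_le_sq' h hn.le).2]
  set a := Real.sqrt ((n + 1 - 2 * t * q) / (2 * n))
  set b := Real.sqrt ((n - 1 + 2 * (1 - t) * q) / (2 * n))
  have ha2 : a ^ 2 = (n + 1 - 2 * t * q) / (2 * n) := Real.sq_sqrt hA
  have hb2 : b ^ 2 = (n - 1 + 2 * (1 - t) * q) / (2 * n) := Real.sq_sqrt hB
  -- Both sides are nonnegative, so it suffices to compare squares, where `a²` and `b²` are known.
  have hab : 2 * a * b = c * ((n + 1 - 2 * t) / n) := by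
    refine (sq_eq_sq₀ (by positivity) (mul_nonneg hc₀ hC)).1 ?_
    rw [mul_pow, mul_pow, mul_pow, ha2, hb2, div_pow]
    field_simp
    linear_combination (1 - c ^ 2) * hn2
  have habc : a ^ 2 + b ^ 2 - 2 * a * b * c = 1 - c ^ 2 := by
    rw [hab, ha2, hb2]
    field_simp
    ring
  obtain ⟨e, he, he₀, he₁⟩ := exists_unit_vector_inner_eq h₀ h₁ hc hq₁ habc
  have hE := isMeasurement_ketBra he
  refine ⟨_, hE, ?_⟩
  have hs₀ := sum_outcomeProb_ketBra hE h₀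
  have hs₁ := sum_outcomeProb_ketBra hE h₁
  rw [mutualInfo_eq ht₀ ht₁ (outcomeProb_ketBra_nonneg hE ψ₀) (outcomeProb_ketBra_nonneg hE ψ₁)
    hs₀ hs₁]
  rw [Fin.sum_univ_two] at hs₀ hs₁ ⊢
  have hp₀ : outcomeProb (ketBra ψ₀) ![ketBra e, 1 - ketBra e] 0 = a ^ 2 := by
    show (ketBra ψ₀ * ketBra e).trace.re = _
    rw [re_trace_ketBra_mul_ketBra, he₀, Complex.norm_real, Real.norm_eq_abs, sq_abs]
  have hp₁ : outcomeProb (ketBra ψ₁) ![ketBra e, 1 - ketBra e] 0 = b ^ 2 := by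
    show (ketBra ψ₁ * ketBra e).trace.re = _
    rw [re_trace_ketBra_mul_ketBra, he₁, Complex.norm_real, Real.norm_eq_abs, sq_abs]
  rw [eq_sub_of_add_eq' hs₀, eq_sub_of_add_eq' hs₁, hp₀, hp₁]
  have hmul : ∀ p r s : ℝ, r = p * s → p * Real.binEntropy (r / p) = p * Real.binEntropy s := by
    rintro p r s rfl
    rcases eq_or_ne p 0 with rfl | hp
    · simp
    · rw [mul_div_cancel_left₀ _ hp]
  -- The posterior probabilities of the second signal are `(1-n)/2` and `(1+n)/2`: equal entropies,
  -- hence equality in Jensen.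
  rw [hmul _ _ (1 - (1 + n) / 2), hmul _ _ ((1 + n) / 2), Real.binEntropy_one_sub]
  · ring
  · rw [ha2, hb2]
    field_simp
    linear_combination -hn2
  · rw [ha2, hb2]
    field_simp
    linear_combination hn2

theorem exists_norm_eq_one_mul_eq_norm (z : ℂ) : ∃ ω : ℂ, ‖ω‖ = 1 ∧ ω * z = ‖z‖ := by
  rcases eq_or_ne z 0 with rfl | hz
  · exact ⟨1, by simp⟩
  have hz' : (‖z‖ : ℂ) ≠ 0 := by exact_mod_cast norm_ne_zero_iff.2 hz
  refine ⟨star z / ‖z‖, ?_, ?_⟩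
  · simp [hz]
  · rw [div_mul_eq_mul_div, Complex.star_def, mul_comm, Complex.mul_conj,
      Complex.normSq_eq_norm_sq, div_eq_iff hz']
    push_cast
    ring

theorem pureStateInfo_one {t : ℝ} (ht₀ : 0 ≤ t) (ht₁ : t ≤ 1) : pureStateInfo t 1 = 0 := by
  rw [pureStateInfo_eq ht₀ ht₁ zero_le_one le_rfl, mul_one,
    ← binEntropy_eq_concurrenceEntropy ht₀ ht₁, sub_self]

theorem exists_mutualInfo_ketBra_eq {t : ℝ} (ht₀ : 0 ≤ t) (ht₁ : t ≤ 1)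
    {ψ₀ ψ₁ : EuclideanSpace ℂ ι} (h₀ : ‖ψ₀‖ = 1) (h₁ : ‖ψ₁‖ = 1) :
    ∃ (m : ℕ) (E : Fin m → Matrix ι ι ℂ), IsMeasurement E ∧
      mutualInfo t (ketBra ψ₀) (ketBra ψ₁) E = pureStateInfo t (‖inner ℂ ψ₀ ψ₁‖ ^ 2) := by
  -- A phase on `ψ₁` does not change the state and makes the overlap real and nonnegative. If it is
  -- `1`, the states coincide and the trivial measurement suffices.
  obtain ⟨ω, hω, hωz⟩ := exists_norm_eq_one_mul_eq_norm (inner ℂ ψ₀ ψ₁)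
  rw [← inner_smul_right] at hωz
  have h₁' : ‖ω • ψ₁‖ = 1 := by rw [norm_smul, hω, h₁, one_mul]
  rw [← ketBra_smul hω ψ₁]
  have hle : ‖inner ℂ ψ₀ ψ₁‖ ≤ 1 := by
    simpa [h₀, h₁] using norm_inner_le_norm (𝕜 := ℂ) ψ₀ ψ₁
  rcases hle.eq_or_lt with h | h
  · rw [h, Complex.ofReal_one] at hωz
    rw [← (inner_eq_one_iff_of_norm_eq_one h₀ h₁').1 hωz, h, one_pow, pureStateInfo_one ht₀ ht₁]
    exact ⟨1, _, isMeasurement_one, mutualInfo_self_one _⟩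
  · exact ⟨2, exists_mutualInfo_ketBra_eq_of_inner_eq ht₀ ht₁ h₀ h₁' (norm_nonneg _) h hωz⟩

/-- Levitin's formula: the accessible information of two pure states. -/
theorem isGreatest_mutualInfoValues_ketBra {t : ℝ} (ht₀ : 0 ≤ t) (ht₁ : t ≤ 1)
    {ψ₀ ψ₁ : EuclideanSpace ℂ ι} (h₀ : ‖ψ₀‖ = 1) (h₁ : ‖ψ₁‖ = 1) :
    IsGreatest (mutualInfoValues t (ketBra ψ₀) (ketBra ψ₁))
      (pureStateInfo t (‖inner ℂ ψ₀ ψ₁‖ ^ 2)) := by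
  obtain ⟨m, E, hE, h⟩ := exists_mutualInfo_ketBra_eq ht₀ ht₁ h₀ h₁
  refine ⟨⟨m, E, hE, h.symm⟩, ?_⟩
  rintro x ⟨m, E, hE, rfl⟩
  exact mutualInfo_ketBra_le ht₀ ht₁ h₀ h₁ hE

end Attainment

/-! ### Matrix factorizations behind Uhlmann's theorem -/

section Factorization

variable {ι κ : Type*} [Fintype ι] [DecidableEq ι] [Fintype κ]

/-- A Hermitian matrix has a Hermitian generalized inverse commuting with it. -/
theorem exists_isHermitian_mul_mul_eq {S : Matrix ι ι ℂ} (hS : S.IsHermitian) :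
    ∃ R : Matrix ι ι ℂ, R.IsHermitian ∧ S * R = R * S ∧ S * R * S = S := by
  have hsa : IsSelfAdjoint S := hS
  have hcont : ∀ f : ℝ → ℝ, ContinuousOn f (spectrum ℝ S) := fun f =>
    Set.Finite.continuousOn (Matrix.finite_real_spectrum) f
  have hid : S = cfc (fun x : ℝ => x) S := (cfc_id' ℝ S).symm
  -- Since `0⁻¹ = 0`, the identity `x * x⁻¹ * x = x` holds on the whole spectrum, kernel included.
  refine ⟨cfc (fun x : ℝ => x⁻¹) S, cfc_predicate _ _, ?_, ?_⟩
  · nth_rw 1 [hid]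
    nth_rw 4 [hid]
    exact cfc_commute_cfc _ _ _
  · nth_rw 1 [hid]
    nth_rw 3 [hid]
    rw [← cfc_mul _ _ _ (hcont _) (hcont _), ← cfc_mul _ _ _ (hcont _) (hcont _)]
    nth_rw 2 [hid]
    refine cfc_congr fun x _ => ?_
    simp

/-- Douglas factorization through a Hermitian matrix. -/
theorem exists_eq_mul_of_mul_conjTranspose_eq {S : Matrix ι ι ℂ} (hS : S.IsHermitian)
    {A : Matrix ι κ ℂ} (h : A * A.conjTranspose = S * S) :
    ∃ W : Matrix ι κ ℂ, A = S * W ∧ (1 - W * W.conjTranspose).PosSemidef := by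
  obtain ⟨R, hR, hcomm, hSRS⟩ := exists_isHermitian_mul_mul_eq hS
  have hP : (S * R).conjTranspose = S * R := by
    rw [Matrix.conjTranspose_mul, hS.eq, hR.eq, hcomm]
  -- `S * R` is the projection onto the range of `S`, which contains the columns of `A`.
  have hzero : (1 - S * R) * A = 0 := by
    have h2 : (1 - S * R) * S = 0 := by rw [Matrix.sub_mul, Matrix.one_mul, hSRS, sub_self]
    rw [← Matrix.self_mul_conjTranspose_eq_zero, Matrix.conjTranspose_mul, Matrix.mul_assoc,
      ← Matrix.mul_assoc A, h, ← Matrix.mul_assoc, ← Matrix.mul_assoc, h2, Matrix.zero_mul,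
      Matrix.zero_mul]
  have hA : A = S * (R * A) := by
    rw [Matrix.sub_mul, Matrix.one_mul, sub_eq_zero] at hzero
    rw [← Matrix.mul_assoc, ← hzero]
  refine ⟨R * A, hA, ?_⟩
  have hWW : R * A * (R * A).conjTranspose = S * R := by
    calc R * A * (R * A).conjTranspose = R * (A * A.conjTranspose) * R := by
          rw [Matrix.conjTranspose_mul, hR.eq]
          simp only [Matrix.mul_assoc]
      _ = R * S * (S * R) := by rw [h]; simp only [Matrix.mul_assoc]
      _ = S * R := by rw [← hcomm, ← Matrix.mul_assoc, hSRS]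
  have hidem : S * R * (S * R) = S * R := by rw [← Matrix.mul_assoc, hSRS]
  have hfac : 1 - S * R = (1 - S * R).conjTranspose * (1 - S * R) := by
    rw [Matrix.conjTranspose_sub, Matrix.conjTranspose_one, hP]
    simp only [sub_mul, mul_sub, one_mul, mul_one, hidem]
    abel
  rw [hWW, hfac]
  exact Matrix.posSemidef_conjTranspose_mul_self _

/-- Two square matrices with the same modulus differ by a unitary factor. -/
theorem exists_unitary_mul_eq {M Q : Matrix ι ι ℂ}
    (h : M.conjTranspose * M = Q.conjTranspose * Q) :
    ∃ U : Matrix ι ι ℂ, U.conjTranspose * U = 1 ∧ M = U * Q := by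
  let m := Matrix.toEuclideanLin M
  let q := Matrix.toEuclideanLin Q
  have hnorm : ∀ x, ‖m x‖ = ‖q x‖ := by
    intro x
    have h1 := inner_mulVec_conjTranspose_mul_self M x x
    have h2 := inner_mulVec_conjTranspose_mul_self Q x x
    rw [h, h2] at h1
    have h3 : ‖q x‖ ^ 2 = ‖m x‖ ^ 2 := by
      rw [← inner_self_eq_norm_sq (𝕜 := ℂ), ← inner_self_eq_norm_sq (𝕜 := ℂ)]
      exact congrArg _ h1
    exact ((sq_eq_sq₀ (norm_nonneg _) (norm_nonneg _)).1 h3).symm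
  -- Since `‖Mx‖ = ‖Qx‖`, the map `Qx ↦ Mx` is a well-defined isometry on the range of `Q`; it
  -- extends to the whole space.
  obtain ⟨s, hs⟩ := q.rangeRestrict.exists_rightInverse_of_surjective q.range_rangeRestrict
  have hqs : ∀ y, q (s y) = y := fun y => congrArg Subtype.val (LinearMap.congr_fun hs y)
  let L : LinearMap.range q →ₗᵢ[ℂ] EuclideanSpace ℂ ι :=
    ⟨m ∘ₗ s, fun y => by
      rw [LinearMap.comp_apply, hnorm, hqs, Submodule.coe_norm]⟩
  have hL : ∀ x, L.extend (q x) = m x := by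
    intro x
    have h1 := L.extend_apply ⟨q x, LinearMap.mem_range_self q x⟩
    refine h1.trans ?_
    rw [← sub_eq_zero]
    show m (s ⟨q x, _⟩) - m x = 0
    rw [← map_sub, ← norm_eq_zero, hnorm, map_sub, hqs, sub_self, norm_zero]
  let U : Matrix ι ι ℂ := Matrix.toEuclideanLin.symm L.extend.toLinearMap
  have hU : ∀ x : EuclideanSpace ℂ ι, WithLp.toLp 2 (U.mulVec x) = L.extend x := by
    intro x
    have : Matrix.toEuclideanLin U = L.extend.toLinearMap := LinearEquiv.apply_symm_apply _ _
    exact LinearMap.congr_fun this x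
  refine ⟨U, ?_, ?_⟩
  · refine Matrix.toEuclideanLin.injective (LinearMap.ext fun x => ext_inner_left ℂ fun y => ?_)
    refine (inner_mulVec_conjTranspose_mul_self U y x).trans ?_
    rw [hU, hU, LinearIsometry.inner_map_map]
    simp
  · refine Matrix.toEuclideanLin.injective (LinearMap.ext fun x => ?_)
    refine (hL x).symm.trans ?_
    rw [← hU]
    simp [q, Matrix.toLpLin_apply, Matrix.mulVec_mulVec]

end Factorization

/-! ### Purifications and Uhlmann's theorem -/

section Purification

variable {ι κ : Type*} [Fintype ι] [Fintype κ]

/-- The coefficient matrix of a vector of a composite space. -/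
def coeffMatrix {ι κ : Type*} (ψ : EuclideanSpace ℂ (ι × κ)) : Matrix ι κ ℂ :=
  fun i b => ψ (i, b)

/-- Purifying `ρ` thus means choosing `A` with `A A* = ρ`, and overlaps become Hilbert–Schmidt inner
products. -/
theorem partialTrace_ketBra {ι : Type*} (ψ : EuclideanSpace ℂ (ι × κ)) :
    partialTrace (ketBra ψ) = coeffMatrix ψ * (coeffMatrix ψ).conjTranspose := by
  ext i j
  simp [partialTrace, ketBra, coeffMatrix, Matrix.mul_apply]

theorem inner_eq_trace (ψ φ : EuclideanSpace ℂ (ι × κ)) :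
    inner ℂ ψ φ = ((coeffMatrix ψ).conjTranspose * coeffMatrix φ).trace := by
  simp only [PiLp.inner_apply, RCLike.inner_apply, Matrix.trace, Matrix.diag, Matrix.mul_apply,
    Matrix.conjTranspose_apply, coeffMatrix, Fintype.sum_prod_type_right, starRingEnd_apply,
    mul_comm]

/-- The vector with a given coefficient matrix. -/
noncomputable def ofCoeffMatrix {ι κ : Type*} (A : Matrix ι κ ℂ) : EuclideanSpace ℂ (ι × κ) :=
  WithLp.toLp 2 fun p => A p.1 p.2

theorem coeffMatrix_ofCoeffMatrix {ι κ : Type*} (A : Matrix ι κ ℂ) :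
    coeffMatrix (ofCoeffMatrix A) = A := rfl

theorem norm_trace_conjTranspose_mul_sq_le (X Y : Matrix ι κ ℂ) :
    ‖(X.conjTranspose * Y).trace‖ ^ 2
      ≤ (X.conjTranspose * X).trace.re * (Y.conjTranspose * Y).trace.re := by
  have h := norm_inner_le_norm (𝕜 := ℂ) (ofCoeffMatrix X) (ofCoeffMatrix Y)
  have hn : ∀ Z : Matrix ι κ ℂ, (Z.conjTranspose * Z).trace.re = ‖ofCoeffMatrix Z‖ ^ 2 := by
    intro Z
    rw [← inner_self_eq_norm_sq (𝕜 := ℂ), inner_eq_trace]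
    rfl
  rw [inner_eq_trace] at h
  rw [hn, hn, ← mul_pow]
  exact pow_le_pow_left₀ (norm_nonneg _) h 2

theorem IsPurification.norm_eq_one {ψ : EuclideanSpace ℂ (ι × κ)} {ρ : Matrix ι ι ℂ}
    (h : IsPurification ψ ρ) (hρ : IsDensityOperator ρ) : ‖ψ‖ = 1 := by
  refine norm_eq_one_of_inner_self_eq_one ?_
  rw [inner_eq_trace, Matrix.trace_mul_comm, ← partialTrace_ketBra, h, hρ.trace_eq_one]

variable [DecidableEq ι]

theorem re_trace_mul_conjTranspose_le {W : Matrix ι κ ℂ} {T : Matrix ι ι ℂ}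
    (hT : T.IsHermitian) (hW : (1 - W * W.conjTranspose).PosSemidef) :
    ((W.conjTranspose * T).conjTranspose * (W.conjTranspose * T)).trace.re ≤ (T * T).trace.re := by
  have h := (hW.conjTranspose_mul_mul_same T).trace_nonneg
  rw [hT.eq, Matrix.mul_sub, Matrix.sub_mul, Matrix.trace_sub, Matrix.mul_one] at h
  have h' := (Complex.le_def.1 h).1
  rw [Complex.sub_re, Complex.zero_re, sub_nonneg] at h'
  refine le_of_eq_of_le (congrArg (fun M : Matrix ι ι ℂ => M.trace.re) ?_) h'
  rw [Matrix.conjTranspose_mul, Matrix.conjTranspose_conjTranspose, hT.eq]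
  simp only [Matrix.mul_assoc]

theorem sqrt_mul_mul_sqrt_posSemidef {ρ₀ ρ₁ : Matrix ι ι ℂ} (h₀ : ρ₀.PosSemidef) :
    (CFC.sqrt ρ₁ * ρ₀ * CFC.sqrt ρ₁).PosSemidef := by
  have hS : (CFC.sqrt ρ₁).IsHermitian :=
    (Matrix.nonneg_iff_posSemidef.1 (CFC.sqrt_nonneg ρ₁)).isHermitian
  have h := h₀.conjTranspose_mul_mul_same (CFC.sqrt ρ₁)
  rwa [hS.eq] at h

/-- The easy half of Uhlmann's theorem. -/
theorem norm_inner_le_fidelity {ρ₀ ρ₁ : Matrix ι ι ℂ} (h₀ : ρ₀.PosSemidef) (h₁ : ρ₁.PosSemidef)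
    {ψ₀ ψ₁ : EuclideanSpace ℂ (ι × κ)} (hψ₀ : IsPurification ψ₀ ρ₀) (hψ₁ : IsPurification ψ₁ ρ₁) :
    ‖inner ℂ ψ₀ ψ₁‖ ≤ fidelity ρ₀ ρ₁ := by
  rw [IsPurification, partialTrace_ketBra] at hψ₀ hψ₁
  rw [inner_eq_trace, fidelity]
  have hG := sqrt_mul_mul_sqrt_posSemidef (ρ₁ := ρ₁) h₀
  set A₀ := coeffMatrix ψ₀
  set A₁ := coeffMatrix ψ₁
  set S := CFC.sqrt ρ₁
  set Q := CFC.sqrt (S * ρ₀ * S)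
  set T := CFC.sqrt Q
  have hS : S.IsHermitian := (Matrix.nonneg_iff_posSemidef.1 (CFC.sqrt_nonneg ρ₁)).isHermitian
  have hQ : Q.PosSemidef := Matrix.nonneg_iff_posSemidef.1 (CFC.sqrt_nonneg _)
  have hT : T.IsHermitian := (Matrix.nonneg_iff_posSemidef.1 (CFC.sqrt_nonneg Q)).isHermitian
  have hSS : S * S = ρ₁ := CFC.sqrt_mul_sqrt_self ρ₁ h₁.nonneg
  have hQQ : Q * Q = S * ρ₀ * S := CFC.sqrt_mul_sqrt_self _ hG.nonneg
  have hTT : T * T = Q := CFC.sqrt_mul_sqrt_self _ hQ.nonneg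
  obtain ⟨W, hW, hWle⟩ := exists_eq_mul_of_mul_conjTranspose_eq hS (hψ₁.trans hSS.symm)
  obtain ⟨V, hV, hVle⟩ := exists_eq_mul_of_mul_conjTranspose_eq (A := S * A₀) hQ.isHermitian (by
    rw [hQQ, ← hψ₀, Matrix.conjTranspose_mul, hS.eq]
    simp only [Matrix.mul_assoc])
  have hV' : A₀.conjTranspose * S = V.conjTranspose * Q := by
    have := congrArg Matrix.conjTranspose hV
    rwa [Matrix.conjTranspose_mul, Matrix.conjTranspose_mul, hS.eq, hQ.isHermitian.eq] at this
  -- From `A₁ = S W` and `S A₀ = Q V`, the overlap is `tr (V* Q W)`. Splitting `Q = T T` evenly lets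
  -- Cauchy–Schwarz and `W W*, V V* ≤ 1` bound it by `tr Q`.
  have htr : (A₀.conjTranspose * A₁).trace
      = ((W.conjTranspose * T).conjTranspose * (V.conjTranspose * T)).trace := by
    rw [hW, ← Matrix.mul_assoc, hV', ← hTT, Matrix.conjTranspose_mul,
      Matrix.conjTranspose_conjTranspose, hT.eq, ← Matrix.mul_assoc, Matrix.mul_assoc _ T W,
      Matrix.trace_mul_comm]
  have hcs := norm_trace_conjTranspose_mul_sq_le (W.conjTranspose * T) (V.conjTranspose * T)
  rw [← htr] at hcs
  have hw := re_trace_mul_conjTranspose_le hT hWle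
  have hv := re_trace_mul_conjTranspose_le hT hVle
  rw [hTT] at hw hv
  have hQ0 : 0 ≤ Q.trace.re := (Complex.le_def.1 hQ.trace_nonneg).1
  refine le_of_sq_le_sq ?_ hQ0
  refine hcs.trans ((mul_le_mul hw hv ?_ hQ0).trans_eq (sq _).symm)
  exact (Complex.le_def.1 (Matrix.posSemidef_conjTranspose_mul_self _).trace_nonneg).1

/-- Uhlmann's theorem: the fidelity is the overlap of some pair of purifications. -/
theorem exists_isPurification_norm_inner_eq_fidelity {ρ₀ ρ₁ : Matrix ι ι ℂ} (h₀ : ρ₀.PosSemidef)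
    (h₁ : ρ₁.PosSemidef) : ∃ ψ₀ ψ₁ : EuclideanSpace ℂ (ι × ι),
      IsPurification ψ₀ ρ₀ ∧ IsPurification ψ₁ ρ₁ ∧ ‖inner ℂ ψ₀ ψ₁‖ = fidelity ρ₀ ρ₁ := by
  have hG := sqrt_mul_mul_sqrt_posSemidef (ρ₁ := ρ₁) h₀
  rw [fidelity]
  set S₀ := CFC.sqrt ρ₀
  set S₁ := CFC.sqrt ρ₁
  set Q := CFC.sqrt (S₁ * ρ₀ * S₁)
  have hS₀ : S₀.conjTranspose = S₀ :=
    (Matrix.nonneg_iff_posSemidef.1 (CFC.sqrt_nonneg ρ₀)).isHermitian.eq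
  have hS₁ : S₁.conjTranspose = S₁ :=
    (Matrix.nonneg_iff_posSemidef.1 (CFC.sqrt_nonneg ρ₁)).isHermitian.eq
  have hQ : Q.PosSemidef := Matrix.nonneg_iff_posSemidef.1 (CFC.sqrt_nonneg _)
  have hSS₀ : S₀ * S₀ = ρ₀ := CFC.sqrt_mul_sqrt_self ρ₀ h₀.nonneg
  have hSS₁ : S₁ * S₁ = ρ₁ := CFC.sqrt_mul_sqrt_self ρ₁ h₁.nonneg
  have hQQ : Q * Q = S₁ * ρ₀ * S₁ := CFC.sqrt_mul_sqrt_self _ hG.nonneg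
  -- Polar decomposition `√ρ₀ √ρ₁ = U Q`. Rotating `√ρ₀` to `√ρ₀ U` keeps it a purification and
  -- turns the overlap into `tr Q`.
  obtain ⟨U, hU, hM⟩ := exists_unitary_mul_eq (M := S₀ * S₁) (Q := Q) (by
    rw [hQ.isHermitian.eq, hQQ, ← hSS₀, Matrix.conjTranspose_mul, hS₀, hS₁]
    simp only [Matrix.mul_assoc])
  have hU' : U * U.conjTranspose = 1 := mul_eq_one_comm.1 hU
  refine ⟨ofCoeffMatrix (S₀ * U), ofCoeffMatrix S₁, ?_, ?_, ?_⟩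
  · rw [IsPurification, partialTrace_ketBra, coeffMatrix_ofCoeffMatrix, Matrix.conjTranspose_mul,
      Matrix.mul_assoc, ← Matrix.mul_assoc U, hU', Matrix.one_mul, hS₀, hSS₀]
  · rw [IsPurification, partialTrace_ketBra, coeffMatrix_ofCoeffMatrix, hS₁, hSS₁]
  · rw [inner_eq_trace, coeffMatrix_ofCoeffMatrix, coeffMatrix_ofCoeffMatrix,
      Matrix.conjTranspose_mul, hS₀, Matrix.mul_assoc, hM, ← Matrix.mul_assoc, hU, Matrix.one_mul]
    exact congrArg Complex.re (Complex.norm_of_nonneg' hQ.trace_nonneg)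

/-! ### Measurements of a subsystem -/

variable [DecidableEq κ]

open scoped Kronecker in
theorem trace_mul_kronecker_one {ι : Type*} [Fintype ι] (M : Matrix (ι × κ) (ι × κ) ℂ) (E : Matrix ι ι ℂ) :
    (M * (E ⊗ₖ (1 : Matrix κ κ ℂ))).trace = (partialTrace M * E).trace := by
  simp only [Matrix.trace, Matrix.diag, Matrix.mul_apply, partialTrace, Fintype.sum_prod_type,
    Matrix.kroneckerMap_apply, Matrix.one_apply, mul_ite, mul_one, mul_zero, Finset.sum_ite_eq',
    Finset.mem_univ, if_true, Finset.sum_mul]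
  exact Finset.sum_congr rfl fun i _ => Finset.sum_comm

open scoped Kronecker in
theorem IsMeasurement.kronecker_one {m : ℕ} {E : Fin m → Matrix ι ι ℂ} (hE : IsMeasurement E) :
    IsMeasurement fun b => E b ⊗ₖ (1 : Matrix κ κ ℂ) := by
  refine ⟨fun b => (hE.posSemidef b).kronecker Matrix.PosSemidef.one, ?_⟩
  rw [← Matrix.one_kronecker_one, ← hE.sum_eq_one]
  ext i j
  simp only [Matrix.sum_apply, Matrix.kroneckerMap_apply, Finset.sum_mul]

open scoped Kronecker in
/-- Measurements on a subsystem are measurements on the composite system. -/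
theorem mutualInfoValues_subset_of_isPurification {t : ℝ} {ρ₀ ρ₁ : Matrix ι ι ℂ}
    {ψ₀ ψ₁ : EuclideanSpace ℂ (ι × κ)} (h₀ : IsPurification ψ₀ ρ₀) (h₁ : IsPurification ψ₁ ρ₁) :
    mutualInfoValues t ρ₀ ρ₁ ⊆ mutualInfoValues t (ketBra ψ₀) (ketBra ψ₁) := by
  rintro x ⟨m, E, hE, rfl⟩
  refine ⟨m, _, hE.kronecker_one (κ := κ), ?_⟩
  have hp : ∀ (ψ : EuclideanSpace ℂ (ι × κ)) (ρ : Matrix ι ι ℂ), IsPurification ψ ρ →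
      outcomeProb (ketBra ψ) (fun b => E b ⊗ₖ (1 : Matrix κ κ ℂ))
        = outcomeProb ρ E := by
    rintro ψ ρ rfl
    funext b
    exact congrArg Complex.re (trace_mul_kronecker_one _ _)
  simp only [mutualInfo, funext (outcomeProb_averageState _ _ _ _)]
  rw [hp _ _ h₀, hp _ _ h₁]

theorem mutualInfoValues_nonempty (t : ℝ) (ρ₀ ρ₁ : Matrix ι ι ℂ) :
    (mutualInfoValues t ρ₀ ρ₁).Nonempty :=
  ⟨_, 1, _, isMeasurement_one, rfl⟩

theorem accessibleInfo_ketBra {t : ℝ} (ht₀ : 0 ≤ t) (ht₁ : t ≤ 1)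
    {ψ₀ ψ₁ : EuclideanSpace ℂ ι} (h₀ : ‖ψ₀‖ = 1) (h₁ : ‖ψ₁‖ = 1) :
    accessibleInfo t (ketBra ψ₀) (ketBra ψ₁) = pureStateInfo t (‖inner ℂ ψ₀ ψ₁‖ ^ 2) :=
  (isGreatest_mutualInfoValues_ketBra ht₀ ht₁ h₀ h₁).csSup_eq

end Purification

/-! ### The purification bound and its optimality -/

theorem mainTheorem11 (D : ℕ) (ρ₀ ρ₁ : Matrix (Fin D) (Fin D) ℂ)
    (hρ₀ : IsDensityOperator ρ₀) (hρ₁ : IsDensityOperator ρ₁)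
    (t : ℝ) (ht₀ : 0 ≤ t) (ht₁ : t ≤ 1) :
    -- the supremum defining the accessible information is over a bounded nonempty set
    (mutualInfoValues t ρ₀ ρ₁).Nonempty ∧ BddAbove (mutualInfoValues t ρ₀ ρ₁) ∧
    -- every pair of purifications gives an upper bound, explicitly computed from its overlap
    (∀ (k : ℕ) (ψ₀ ψ₁ : EuclideanSpace ℂ (Fin D × Fin k)),
      IsPurification ψ₀ ρ₀ → IsPurification ψ₁ ρ₁ →
        accessibleInfo t ρ₀ ρ₁ ≤ accessibleInfo t (ketBra ψ₀) (ketBra ψ₁) ∧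
        IsGreatest (mutualInfoValues t (ketBra ψ₀) (ketBra ψ₁))
          (accessibleInfo t (ketBra ψ₀) (ketBra ψ₁)) ∧
        accessibleInfo t (ketBra ψ₀) (ketBra ψ₁) =
          pureStateInfo t (‖inner ℂ ψ₀ ψ₁‖ ^ 2) ∧
        ‖inner ℂ ψ₀ ψ₁‖ ^ 2 ≤ fidelity ρ₀ ρ₁ ^ 2) ∧
    -- the largest overlap is attained, already with an auxiliary system of dimension `D`
    (∃ ψ₀ ψ₁ : EuclideanSpace ℂ (Fin D × Fin D),
      IsPurification ψ₀ ρ₀ ∧ IsPurification ψ₁ ρ₁ ∧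
        ‖inner ℂ ψ₀ ψ₁‖ ^ 2 = fidelity ρ₀ ρ₁ ^ 2) ∧
    -- a larger overlap gives a tighter bound
    AntitoneOn (fun q => pureStateInfo t q) (Set.Icc 0 1) ∧
    -- the bound `P(t)`, the best one obtained from purifications
    accessibleInfo t ρ₀ ρ₁ ≤ purificationBound t ρ₀ ρ₁ ∧
    IsLeast (purificationInfoValues t ρ₀ ρ₁) (purificationBound t ρ₀ ρ₁) := by
  have hpos₀ := hρ₀.posSemidef
  have hpos₁ := hρ₁.posSemidef
  have hne := mutualInfoValues_nonempty t ρ₀ ρ₁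
  have hanti := antitoneOn_pureStateInfo ht₀ ht₁
  have hpure : ∀ (k : ℕ) (ψ₀ ψ₁ : EuclideanSpace ℂ (Fin D × Fin k)),
      IsPurification ψ₀ ρ₀ → IsPurification ψ₁ ρ₁ →
        accessibleInfo t ρ₀ ρ₁ ≤ accessibleInfo t (ketBra ψ₀) (ketBra ψ₁) ∧
        IsGreatest (mutualInfoValues t (ketBra ψ₀) (ketBra ψ₁))
          (accessibleInfo t (ketBra ψ₀) (ketBra ψ₁)) ∧
        accessibleInfo t (ketBra ψ₀) (ketBra ψ₁) =
          pureStateInfo t (‖inner ℂ ψ₀ ψ₁‖ ^ 2) ∧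
        ‖inner ℂ ψ₀ ψ₁‖ ^ 2 ≤ fidelity ρ₀ ρ₁ ^ 2 := by
    intro k ψ₀ ψ₁ hψ₀ hψ₁
    have hn₀ := hψ₀.norm_eq_one hρ₀
    have hn₁ := hψ₁.norm_eq_one hρ₁
    have hg := isGreatest_mutualInfoValues_ketBra ht₀ ht₁ hn₀ hn₁
    have heq := accessibleInfo_ketBra ht₀ ht₁ hn₀ hn₁
    refine ⟨?_, heq ▸ hg, heq, ?_⟩
    · rw [heq]
      exact csSup_le hne fun x hx => hg.2 (mutualInfoValues_subset_of_isPurification hψ₀ hψ₁ hx)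
    · exact pow_le_pow_left₀ (norm_nonneg _) (norm_inner_le_fidelity hpos₀ hpos₁ hψ₀ hψ₁) 2
  -- This pair bounds the set of mutual informations, yields the bound `P(t)`, and attains the
  -- minimum.
  obtain ⟨φ₀, φ₁, hφ₀, hφ₁, hφ⟩ := exists_isPurification_norm_inner_eq_fidelity hpos₀ hpos₁
  have hφ2 : ‖inner ℂ φ₀ φ₁‖ ^ 2 = fidelity ρ₀ ρ₁ ^ 2 := by rw [hφ]
  obtain ⟨hle, hgr, heq, -⟩ := hpure D φ₀ φ₁ hφ₀ hφ₁
  rw [hφ2] at heq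
  have hmem : ∀ (k : ℕ) (ψ₀ ψ₁ : EuclideanSpace ℂ (Fin D × Fin k)),
      IsPurification ψ₀ ρ₀ → IsPurification ψ₁ ρ₁ → ‖inner ℂ ψ₀ ψ₁‖ ^ 2 ∈ Set.Icc (0 : ℝ) 1 :=
    fun k ψ₀ ψ₁ hψ₀ hψ₁ => norm_inner_sq_mem_Icc (hψ₀.norm_eq_one hρ₀) (hψ₁.norm_eq_one hρ₁)
  refine ⟨hne, hgr.bddAbove.mono (mutualInfoValues_subset_of_isPurification hφ₀ hφ₁), hpure,
    ⟨φ₀, φ₁, hφ₀, hφ₁, hφ2⟩, hanti, hle.trans_eq heq, ⟨D, φ₀, φ₁, hφ₀, hφ₁, heq.symm⟩, ?_⟩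
  rintro x ⟨k, ψ₀, ψ₁, hψ₀, hψ₁, rfl⟩
  obtain ⟨-, -, hx, hxF⟩ := hpure k ψ₀ ψ₁ hψ₀ hψ₁
  rw [hx]
  exact hanti (hmem k ψ₀ ψ₁ hψ₀ hψ₁) (hφ2 ▸ hmem D φ₀ φ₁ hφ₀ hφ₁) hxF
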